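/- A *list system* with win probability $p\in[0,1]$ is played in coups $n=1,2,\dots$; each coup is won with probability $p$, independently of everything that happened before it. It consists of targets $T_n\in\mathbb R$, bets $B_n\in\mathbb R$ and lengths $l_n\in\{0,1,2,\dots\}$, with constant initial values $T_0>0$ and $l_0\ge 1$, such that: - the bet $B_n\in[0,T_{n-1}]$ is chosen before the $n$-th coup and may depend on the entire history up to that time; - if the $n$-th coup is won, then $T_n=T_{n-1}-B_n$ and $l_n=\max(l_{n-1}-2,0)$; if it is lost, then $T_n=T_{n-1}+B_n$ and, provided $l_{n-1}\ge 1$, $l_n=l_{n-1}+1$; - if $l_{n-1}\in\{1,2\}$, then $B_n=T_{n-1}$; if $l_{n-1}=0$, the play is over and $l_n=0$ (so that $T_m=B_{m+1}=l_m=0$ for all $m\ge n-1$). Let $N=\inf\{n: l_n=0\}\in\{1,2,\dots\}\cup\{\infty\}$ and let $B^\star=\sup\{B_n : n\ge 1,\ n\le N\}\in[0,\infty]$ be the largest bet. **Theorem.** For every list system with win probability $p$: 1. if $p>\frac12$, then $\mathbb E[B^\star]<\infty$; 2. if $\frac13<p<\frac12$, then $\mathbb E[B^\star]=\infty$; 3.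 if $p\le\frac13$ and there are constants $c_1>0$ and $c_2\in\mathbb R$ such that, almost surely, $B_n\ge c_1l_{n-1}+c_2$ for all $n\ge1$ with $n\le N$, then $\mathbb E[B^\star]=\infty$. -/

import Mathlib

open MeasureTheory ProbabilityTheory
open scoped ENNReal

/-- A list system on the probability space `(Ω, μ)`, whose coups are won independently with
probability `p`. Coups are numbered `1, 2, 3, …`; the values `bet 0` and `win 0` are never used. -/
structure ListSystem {Ω : Type*} [mΩ : MeasurableSpace Ω] (μ : Measure Ω) (p : ℝ) where
  /-- `history n` is the information available just after coup `n`
  (before coup `1`, if `n = 0`). -/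
  history : Filtration ℕ mΩ
  /-- `win n` is the event that coup `n` is won. -/
  win : ℕ → Set Ω
  /-- `target n` is the remaining target profit `T_n` after coup `n`. -/
  target : ℕ → Ω → ℝ
  /-- `bet n` is the size `B_n` of the bet at coup `n`. -/
  bet : ℕ → Ω → ℝ
  /-- `length n` is the length `l_n` after coup `n`. -/
  length : ℕ → Ω → ℕ
  /-- The initial target `T_0`, a constant. -/
  initTarget : ℝ
  /-- The initial length `l_0`, a constant. -/
  initLength : ℕ
  initTarget_pos : 0 < initTarget
  initLength_pos : 1 ≤ initLength
  target_zero : ∀ ω, target 0 ω = initTarget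
  length_zero : ∀ ω, length 0 ω = initLength
  /-- The outcome of a coup is known after it, -/
  measurableSet_win : ∀ n, MeasurableSet[history (n + 1)] (win (n + 1))
  /-- is independent of everything that happened before it, -/
  indep_win : ∀ n, Indep (history n) (MeasurableSpace.generateFrom {win (n + 1)}) μ
  /-- and is a win with probability `p`. -/
  measure_win : ∀ n, μ (win (n + 1)) = ENNReal.ofReal p
  /-- The bet may depend on the entire history before the coup. -/
  measurable_bet : ∀ n, Measurable[history n] (bet (n + 1))
  bet_nonneg : ∀ n ω, 0 ≤ bet (n + 1) ω
  bet_le : ∀ n ω, bet (n + 1) ω ≤ target n ω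
  target_win : ∀ n, ∀ ω ∈ win (n + 1), target (n + 1) ω = target n ω - bet (n + 1) ω
  target_lose : ∀ n, ∀ ω ∉ win (n + 1), target (n + 1) ω = target n ω + bet (n + 1) ω
  /-- After a win the length drops by `2`, truncated at `0`. -/
  length_win : ∀ n, ∀ ω ∈ win (n + 1), length (n + 1) ω = length n ω - 2
  length_lose : ∀ n, ∀ ω ∉ win (n + 1), length n ω ≠ 0 → length (n + 1) ω = length n ω + 1
  /-- The system has stopped once the length is `0`. -/
  length_stop : ∀ n ω, length n ω = 0 → length (n + 1) ω = 0
  /-- Termination condition: the whole target is bet when the length is `1` or `2`. -/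
  bet_terminal : ∀ n ω, length n ω = 1 ∨ length n ω = 2 → bet (n + 1) ω = target n ω

namespace ListSystem

variable {Ω : Type*} [MeasurableSpace Ω] {μ : Measure Ω} {p : ℝ}

/-- The number `N` of coups: the first time at which the length is `0`, and `⊤` if there is none. -/
noncomputable def duration (S : ListSystem μ p) (ω : Ω) : ℕ∞ :=
  ⨅ (n : ℕ) (_ : S.length n ω = 0), (n : ℕ∞)

/-- The largest bet `B* = sup {B_n : 1 ≤ n ≤ N}`, in `[0, ∞]`. -/
noncomputable def maxBet (S : ListSystem μ p) (ω : Ω) : ℝ≥0∞ :=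
  ⨆ (n : ℕ) (_ : 1 ≤ n ∧ (n : ℕ∞) ≤ S.duration ω), ENNReal.ofReal (S.bet n ω)

end ListSystem

namespace ListSystem

variable {Ω : Type*} [mΩ : MeasurableSpace Ω] {μ : Measure Ω} {p : ℝ}

/-! Each case compares one-step means, computed by `lintegral_succ`. For p > 1/2, E T_{n+1} + (2p -
1) E B_{n+1} = E T_n telescopes, so the sum of all expected bets, which dominates E B*, is at most
T_0 / (2p - 1). For 1/3 < p < 1/2, some θ < 1 keeps E T_n^θ ≥ T_0^θ
(`rpow_initTarget_le_lintegral`), while a weight z^l on positive lengths decays in mean like r^n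
with r < 1 (`lintegral_expWeight_le`). As T_n = 0 once l_n = 0, Hölder gives T_0^θ ≤ (E T_n)^θ
(z^{l_0} r^n)^{1-θ}. If E B* were finite, E T_n would grow at most linearly and the right side would
tend to 0. For p ≤ 1/3 the length is a submartingale. If E B* were finite, the lower bound on the
bets would give the lengths an integrable majorant, so they would converge a.s., necessarily to 0.
Dominated convergence then contradicts E l_n ≥ l_0 ≥ 1. -/

lemma measurableSet_win' (S : ListSystem μ p) (n : ℕ) : MeasurableSet (S.win (n + 1)) :=
  S.history.le _ _ (S.measurableSet_win n)

lemma measure_lose [IsProbabilityMeasure μ] (S : ListSystem μ p) (hp0 : 0 ≤ p) (n : ℕ) :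
    μ (S.win (n + 1))ᶜ = ENNReal.ofReal (1 - p) := by
  rw [prob_compl_eq_one_sub (S.measurableSet_win' n), S.measure_win, ENNReal.ofReal_sub _ hp0,
    ENNReal.ofReal_one]

/-- Integrating out the coup `n + 1`, given the history up to time `n`. -/
lemma lintegral_succ [IsProbabilityMeasure μ] (S : ListSystem μ p) (hp0 : 0 ≤ p) (n : ℕ)
    {f g h : Ω → ℝ≥0∞} (hg : Measurable[S.history n] g) (hh : Measurable[S.history n] h)
    (hw : ∀ ω ∈ S.win (n + 1), f ω = g ω) (hl : ∀ ω ∉ S.win (n + 1), f ω = h ω) :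
    ∫⁻ ω, f ω ∂μ = ∫⁻ ω, (ENNReal.ofReal p * g ω + ENNReal.ofReal (1 - p) * h ω) ∂μ := by
  have hle := S.history.le n
  have hW := S.measurableSet_win' n
  -- Factorization by independence, needed for A the win event and for its complement.
  have key : ∀ (A : Set Ω) (k : Ω → ℝ≥0∞), MeasurableSet A →
      MeasurableSet[MeasurableSpace.generateFrom {S.win (n + 1)}] A →
      Measurable[S.history n] k →
      ∫⁻ ω, k ω * A.indicator (fun _ => 1) ω ∂μ = μ A * ∫⁻ ω, k ω ∂μ := by
    intro A k hA hA' hk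
    rw [lintegral_mul_indicator_eq_lintegral_mul_lintegral_indicator hle 1 hA _ hk,
      lintegral_indicator hA, lintegral_const, one_mul, Measure.restrict_apply_univ, mul_comm]
    rw [IndepSets_iff]
    rintro s t hs rfl
    exact (Indep_iff _ _ μ).1 (S.indep_win n) s t hs hA'
  have hgen : MeasurableSet[MeasurableSpace.generateFrom {S.win (n + 1)}] (S.win (n + 1)) :=
    MeasurableSpace.measurableSet_generateFrom rfl
  have hg' := hg.mono hle le_rfl
  have hh' := hh.mono hle le_rfl
  rw [lintegral_add_left (hg'.const_mul _), lintegral_const_mul _ hg', lintegral_const_mul _ hh',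
    ← S.measure_win n, ← S.measure_lose hp0 n, ← key _ g hW hgen hg,
    ← key _ h hW.compl hgen.compl hh, ← lintegral_add_left]
  · refine lintegral_congr fun ω => ?_
    by_cases hω : ω ∈ S.win (n + 1) <;> simp [hω, hw, hl]
  · exact hg'.mul (measurable_const.indicator hW)

/-! ### Pathwise properties of targets, lengths and the largest bet -/

lemma target_nonneg (S : ListSystem μ p) (n : ℕ) (ω : Ω) : 0 ≤ S.target n ω :=
  (S.bet_nonneg n ω).trans (S.bet_le n ω)

lemma measurable_target (S : ListSystem μ p) (n : ℕ) : Measurable[S.history n] (S.target n) := by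
  induction n with
  | zero =>
    rw [funext S.target_zero]
    exact measurable_const
  | succ n ih =>
    classical
    have hle : S.history n ≤ S.history (n + 1) := S.history.mono n.le_succ
    have hB := (S.measurable_bet n).mono hle le_rfl
    have hT := ih.mono hle le_rfl
    have : S.target (n + 1) = (S.win (n + 1)).piecewise
        (fun ω => S.target n ω - S.bet (n + 1) ω) (fun ω => S.target n ω + S.bet (n + 1) ω) := by
      funext ω
      by_cases hω : ω ∈ S.win (n + 1) <;> simp [hω, S.target_win n ω, S.target_lose n ω]
    rw [this]
    exact Measurable.piecewise (S.measurableSet_win n) (hT.sub hB) (hT.add hB)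

/-- The length after a loss, as a function of the length before it. -/
def lengthLose (k : ℕ) : ℕ := if k = 0 then 0 else k + 1

lemma length_succ_win (S : ListSystem μ p) {n : ℕ} {ω : Ω} (h : ω ∈ S.win (n + 1)) :
    S.length (n + 1) ω = S.length n ω - 2 := S.length_win n ω h

lemma length_succ_lose (S : ListSystem μ p) {n : ℕ} {ω : Ω} (h : ω ∉ S.win (n + 1)) :
    S.length (n + 1) ω = lengthLose (S.length n ω) := by
  unfold lengthLose
  split_ifs with h0
  · exact length_stop S n ω h0
  · exact S.length_lose n ω h h0

lemma measurable_length (S : ListSystem μ p) (n : ℕ) : Measurable[S.history n] (S.length n) := by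
  induction n with
  | zero =>
    rw [funext S.length_zero]
    exact measurable_const
  | succ n ih =>
    classical
    have hle : S.history n ≤ S.history (n + 1) := S.history.mono n.le_succ
    have hl := ih.mono hle le_rfl
    have : S.length (n + 1) = (S.win (n + 1)).piecewise
        (fun ω => S.length n ω - 2) (fun ω => lengthLose (S.length n ω)) := by
      funext ω
      by_cases hω : ω ∈ S.win (n + 1) <;> simp [hω, S.length_succ_win, S.length_succ_lose]
    rw [this]
    exact Measurable.piecewise (S.measurableSet_win n)
      ((measurable_from_nat (f := fun k => k - 2)).comp hl)
      ((measurable_from_nat (f := lengthLose)).comp hl)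

lemma length_eq_zero_of_le (S : ListSystem μ p) {m n : ℕ} (hmn : m ≤ n) {ω : Ω}
    (h : S.length m ω = 0) : S.length n ω = 0 := by
  induction n, hmn using Nat.le_induction with
  | base => exact h
  | succ n _ ih => exact length_stop S n ω ih

/-- Length 0 is first reached by a win from length 1 or 2, where the whole target was bet. -/
lemma target_eq_zero (S : ListSystem μ p) {n : ℕ} {ω : Ω} (h : S.length n ω = 0) :
    S.target n ω = 0 := by
  induction n with
  | zero =>
    have := S.initLength_pos
    rw [S.length_zero] at h
    omega
  | succ n ih =>
    have h1 := S.bet_nonneg n ω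
    have h2 := S.bet_le n ω
    by_cases hw : ω ∈ S.win (n + 1)
    · rw [S.target_win n ω hw]
      by_cases h0 : S.length n ω = 0
      · linarith [ih h0]
      · rw [S.length_win n ω hw] at h
        rw [S.bet_terminal n ω (by omega), sub_self]
    · rw [S.target_lose n ω hw]
      by_cases h0 : S.length n ω = 0
      · linarith [ih h0]
      · rw [S.length_lose n ω hw h0] at h
        omega

lemma succ_le_duration (S : ListSystem μ p) {n : ℕ} {ω : Ω} (h : S.length n ω ≠ 0) :
    ((n + 1 : ℕ) : ℕ∞) ≤ S.duration ω := by
  refine le_iInf₂ fun m hm => ?_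
  by_contra hlt
  have : m ≤ n := by
    have := not_le.1 hlt
    rw [Nat.cast_lt] at this
    omega
  exact h (S.length_eq_zero_of_le this hm)

/-- Bets vanish after the play is over, so the restriction to coups up to N can be dropped. -/
lemma ofReal_bet_le_maxBet (S : ListSystem μ p) (n : ℕ) (ω : Ω) :
    ENNReal.ofReal (S.bet (n + 1) ω) ≤ S.maxBet ω := by
  by_cases h : S.length n ω = 0
  · have := S.bet_le n ω
    rw [S.target_eq_zero h] at this
    rw [ENNReal.ofReal_of_nonpos this]
    exact zero_le
  · exact le_iSup₂ (f := fun (n : ℕ) (_ : 1 ≤ n ∧ (n : ℕ∞) ≤ S.duration ω) =>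
      ENNReal.ofReal (S.bet n ω)) (n + 1) ⟨by omega, S.succ_le_duration h⟩

lemma maxBet_le_tsum (S : ListSystem μ p) (ω : Ω) :
    S.maxBet ω ≤ ∑' n, ENNReal.ofReal (S.bet (n + 1) ω) := by
  refine iSup₂_le fun n hn => ?_
  obtain ⟨m, rfl⟩ : ∃ m, n = m + 1 := ⟨n - 1, by omega⟩
  exact ENNReal.le_tsum m

lemma ofReal_target_le (S : ListSystem μ p) (n : ℕ) (ω : Ω) :
    ENNReal.ofReal (S.target n ω) ≤ ENNReal.ofReal S.initTarget + n * S.maxBet ω := by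
  induction n with
  | zero => simp [S.target_zero]
  | succ n ih =>
    have hle : S.target (n + 1) ω ≤ S.target n ω + S.bet (n + 1) ω := by
      by_cases hw : ω ∈ S.win (n + 1)
      · rw [S.target_win n ω hw]
        linarith [S.bet_nonneg n ω]
      · rw [S.target_lose n ω hw]
    calc ENNReal.ofReal (S.target (n + 1) ω)
        ≤ ENNReal.ofReal (S.target n ω) + ENNReal.ofReal (S.bet (n + 1) ω) :=
          (ENNReal.ofReal_le_ofReal hle).trans ENNReal.ofReal_add_le
      _ ≤ (ENNReal.ofReal S.initTarget + n * S.maxBet ω) + S.maxBet ω :=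
          add_le_add ih (S.ofReal_bet_le_maxBet n ω)
      _ = _ := by push_cast; ring

/-! ### The case p > 1/2 -/

/-- With a positive expected gain per unit bet, the largest bet has finite expectation. -/
lemma lintegral_maxBet_lt_top [IsProbabilityMeasure μ] (S : ListSystem μ p) (hp1 : p ≤ 1)
    (hp : 1 / 2 < p) : ∫⁻ ω, S.maxBet ω ∂μ < ∞ := by
  have hp0 : 0 ≤ p := by linarith
  have hB n : Measurable (S.bet (n + 1)) := (S.measurable_bet n).mono (S.history.le n) le_rfl
  have step n : ∫⁻ ω, ENNReal.ofReal (S.target (n + 1) ω) ∂μ +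
      ENNReal.ofReal (2 * p - 1) * ∫⁻ ω, ENNReal.ofReal (S.bet (n + 1) ω) ∂μ =
      ∫⁻ ω, ENNReal.ofReal (S.target n ω) ∂μ := by
    have hT' := S.measurable_target n
    have hB' := S.measurable_bet n
    rw [S.lintegral_succ hp0 n
      (g := fun ω => ENNReal.ofReal (S.target n ω - S.bet (n + 1) ω))
      (h := fun ω => ENNReal.ofReal (S.target n ω + S.bet (n + 1) ω))
      (hT'.sub hB').ennreal_ofReal (hT'.add hB').ennreal_ofReal
      (fun ω h => by rw [S.target_win n ω h]) (fun ω h => by rw [S.target_lose n ω h]),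
      ← lintegral_const_mul _ (hB n).ennreal_ofReal,
      ← lintegral_add_right _ ((hB n).ennreal_ofReal.const_mul _)]
    refine lintegral_congr fun ω => ?_
    have h1 := S.bet_nonneg n ω
    have h2 := S.bet_le n ω
    have h3 : 0 ≤ S.target n ω - S.bet (n + 1) ω := by linarith
    have h4 : 0 ≤ S.target n ω + S.bet (n + 1) ω := by linarith
    have h5 : 0 ≤ 1 - p := by linarith
    have h6 : 0 ≤ 2 * p - 1 := by linarith
    rw [← ENNReal.ofReal_mul hp0, ← ENNReal.ofReal_mul h5, ← ENNReal.ofReal_mul h6,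
      ← ENNReal.ofReal_add (by positivity) (by positivity),
      ← ENNReal.ofReal_add (by positivity) (by positivity)]
    congr 1
    ring
  have hsum n : ∫⁻ ω, ENNReal.ofReal (S.target n ω) ∂μ + ∑ k ∈ Finset.range n,
      ENNReal.ofReal (2 * p - 1) * ∫⁻ ω, ENNReal.ofReal (S.bet (k + 1) ω) ∂μ =
      ENNReal.ofReal S.initTarget := by
    induction n with
    | zero => simp [S.target_zero]
    | succ n ih => rw [Finset.sum_range_succ_comm, ← add_assoc, step, ih]
  have hle : ENNReal.ofReal (2 * p - 1) * ∫⁻ ω, S.maxBet ω ∂μ ≤ ENNReal.ofReal S.initTarget := by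
    calc _ ≤ ENNReal.ofReal (2 * p - 1) *
          ∫⁻ ω, ∑' n, ENNReal.ofReal (S.bet (n + 1) ω) ∂μ := by
          gcongr with ω
          exact S.maxBet_le_tsum ω
      _ = ∑' n, ENNReal.ofReal (2 * p - 1) * ∫⁻ ω, ENNReal.ofReal (S.bet (n + 1) ω) ∂μ := by
          rw [lintegral_tsum fun n => (hB n).ennreal_ofReal.aemeasurable, ENNReal.tsum_mul_left]
      _ ≤ _ := by
          rw [ENNReal.tsum_eq_iSup_nat]
          exact iSup_le fun n => (hsum n) ▸ le_add_self
  rw [lt_top_iff_ne_top]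
  intro htop
  have hpos : ENNReal.ofReal (2 * p - 1) ≠ 0 := (ENNReal.ofReal_pos.2 (by linarith)).ne'
  rw [htop, ENNReal.mul_top hpos] at hle
  exact ENNReal.ofReal_ne_top (top_le_iff.1 hle)

/-! ### The case 1/3 < p < 1/2: fractional moments against exponential decay -/

/-- If `θ ≤ 1` and `1 ≤ (1 - p) * 2 ^ θ`, then no bet decreases the expectation of the `θ`-th power
of the target. -/
lemma rpow_le_mean_rpow {p θ t b : ℝ} (hp0 : 0 ≤ p) (hp1 : p ≤ 1) (hθ0 : 0 < θ) (hθ1 : θ ≤ 1)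
    (hθ : 1 ≤ (1 - p) * 2 ^ θ) (hb : 0 ≤ b) (hbt : b ≤ t) :
    t ^ θ ≤ p * (t - b) ^ θ + (1 - p) * (t + b) ^ θ := by
  rcases (hb.trans hbt).eq_or_lt with rfl | ht
  · obtain rfl : b = 0 := le_antisymm hbt hb
    simp [Real.zero_rpow hθ0.ne']
  -- With f the fraction bet, t - ft interpolates between t and 0, and t + ft between t and 2t.
  -- Concavity reduces the claim to f = 0 and f = 1, and the latter is `hθ`.
  obtain ⟨f, rfl⟩ : ∃ f, b = f * t := ⟨b / t, by field_simp⟩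
  have hf0 : 0 ≤ f := nonneg_of_mul_nonneg_left hb ht
  have hf1 : f ≤ 1 := by nlinarith
  have hc := (Real.concaveOn_rpow hθ0.le hθ1).2
  have h1 := hc (x := t) ht.le (y := 0) (by simp) (sub_nonneg.2 hf1) hf0 (by ring)
  have h2 := hc (x := t) ht.le (y := 2 * t) (by simpa using ht.le) (sub_nonneg.2 hf1) hf0 (by ring)
  simp only [smul_eq_mul] at h1 h2
  rw [Real.zero_rpow hθ0.ne', show (1 - f) * t + f * 0 = t - f * t by ring] at h1
  rw [Real.mul_rpow zero_le_two ht.le, show (1 - f) * t + f * (2 * t) = t + f * t by ring] at h2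
  have htθ : 0 < t ^ θ := Real.rpow_pos_of_pos ht θ
  have h3 := mul_le_mul_of_nonneg_left h1 hp0
  have h4 := mul_le_mul_of_nonneg_left h2 (sub_nonneg.2 hp1)
  have h5 := mul_le_mul_of_nonneg_left hθ (mul_nonneg hf0 htθ.le)
  linarith

lemma rpow_initTarget_le_lintegral [IsProbabilityMeasure μ] (S : ListSystem μ p) (hp0 : 0 ≤ p)
    (hp1 : p ≤ 1) {θ : ℝ} (hθ0 : 0 < θ) (hθ1 : θ ≤ 1) (hθ : 1 ≤ (1 - p) * 2 ^ θ) (n : ℕ) :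
    ENNReal.ofReal (S.initTarget ^ θ) ≤ ∫⁻ ω, ENNReal.ofReal (S.target n ω ^ θ) ∂μ := by
  induction n with
  | zero => simp [S.target_zero]
  | succ n ih =>
    have hT := S.measurable_target n
    have hB := S.measurable_bet n
    rw [S.lintegral_succ hp0 n
      (g := fun ω => ENNReal.ofReal ((S.target n ω - S.bet (n + 1) ω) ^ θ))
      (h := fun ω => ENNReal.ofReal ((S.target n ω + S.bet (n + 1) ω) ^ θ))
      ((hT.sub hB).pow_const θ).ennreal_ofReal ((hT.add hB).pow_const θ).ennreal_ofReal
      (fun ω h => by rw [S.target_win n ω h]) (fun ω h => by rw [S.target_lose n ω h])]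
    refine ih.trans (lintegral_mono fun ω => ?_)
    have h1 := S.bet_nonneg n ω
    have h2 := S.bet_le n ω
    have h3 : 0 ≤ S.target n ω - S.bet (n + 1) ω := by linarith
    have h4 : 0 ≤ S.target n ω + S.bet (n + 1) ω := by linarith
    have h5 : 0 ≤ 1 - p := by linarith
    rw [← ENNReal.ofReal_mul hp0, ← ENNReal.ofReal_mul h5,
      ← ENNReal.ofReal_add (by positivity) (by positivity)]
    exact ENNReal.ofReal_le_ofReal (rpow_le_mean_rpow hp0 hp1 hθ0 hθ1 hθ h1 h2)

/-- The weight `z ^ k` of a positive length `k`; length `0` has weight `0`. -/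
def expWeight (z : ℝ) (k : ℕ) : ℝ := if k = 0 then 0 else z ^ k

lemma expWeight_nonneg {z : ℝ} (hz : 0 ≤ z) (k : ℕ) : 0 ≤ expWeight z k := by
  unfold expWeight
  split_ifs <;> positivity

lemma one_le_expWeight {z : ℝ} (hz : 1 ≤ z) {k : ℕ} (hk : k ≠ 0) : 1 ≤ expWeight z k := by
  rw [expWeight, if_neg hk]
  exact one_le_pow₀ hz

/-- For k ≥ 3 this is `hr` times z^{k-2}, with equality. For k = 1, 2 a win leads to weight 0, and
(1 - p) z ≤ r suffices. -/
lemma mean_expWeight_le {p z r : ℝ} (hp0 : 0 ≤ p) (hz : 0 < z) (hr : r * z ^ 2 = p + (1 - p) * z ^ 3)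
    (k : ℕ) :
    p * expWeight z (k - 2) + (1 - p) * expWeight z (lengthLose k) ≤ r * expWeight z k := by
  have hqz : (1 - p) * z ≤ r := by
    have : (1 - p) * z * z ^ 2 ≤ r * z ^ 2 := by rw [hr]; linarith
    exact le_of_mul_le_mul_right this (by positivity)
  match k with
  | 0 => simp [expWeight, lengthLose]
  | 1 =>
    simp only [expWeight, lengthLose]
    norm_num
    nlinarith
  | 2 =>
    simp only [expWeight, lengthLose]
    norm_num
    have := mul_le_mul_of_nonneg_right hqz (by positivity : 0 ≤ z ^ 2)
    linarith
  | j + 3 =>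
    have h0 : j + 3 - 2 ≠ 0 := by omega
    have h1 : j + 3 - 2 = j + 1 := by omega
    simp only [expWeight, lengthLose, h0, if_false, Nat.add_eq_zero_iff, OfNat.ofNat_ne_zero,
      and_false, one_ne_zero]
    rw [h1]
    refine le_of_eq ?_
    linear_combination (-z ^ (j + 1)) * hr

lemma lintegral_expWeight_le [IsProbabilityMeasure μ] (S : ListSystem μ p) (hp0 : 0 ≤ p)
    (hp1 : p ≤ 1) {z r : ℝ} (hz : 0 < z) (hr0 : 0 ≤ r) (hr : r * z ^ 2 = p + (1 - p) * z ^ 3)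
    (n : ℕ) :
    ∫⁻ ω, ENNReal.ofReal (expWeight z (S.length n ω)) ∂μ ≤
      ENNReal.ofReal (z ^ S.initLength * r ^ n) := by
  induction n with
  | zero =>
    have := S.initLength_pos
    simp [S.length_zero, expWeight, show S.initLength ≠ 0 by omega]
  | succ n ih =>
    have hl := S.measurable_length n
    have hmeas : ∀ φ : ℕ → ℝ,
        Measurable[S.history n] fun ω => ENNReal.ofReal (φ (S.length n ω)) := fun φ =>
      (measurable_from_nat (f := fun k => ENNReal.ofReal (φ k))).comp hl
    rw [S.lintegral_succ hp0 n
      (g := fun ω => ENNReal.ofReal (expWeight z (S.length n ω - 2)))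
      (h := fun ω => ENNReal.ofReal (expWeight z (lengthLose (S.length n ω))))
      (hmeas fun k => expWeight z (k - 2)) (hmeas fun k => expWeight z (lengthLose k))
      (fun ω h => by rw [S.length_succ_win h]) (fun ω h => by rw [S.length_succ_lose h])]
    calc _ ≤ ∫⁻ ω, ENNReal.ofReal r * ENNReal.ofReal (expWeight z (S.length n ω)) ∂μ := by
          refine lintegral_mono fun ω => ?_
          have h5 : 0 ≤ 1 - p := by linarith
          have h6 := expWeight_nonneg hz.le
          rw [← ENNReal.ofReal_mul hp0, ← ENNReal.ofReal_mul h5, ← ENNReal.ofReal_mul hr0,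
            ← ENNReal.ofReal_add (mul_nonneg hp0 (h6 _)) (mul_nonneg h5 (h6 _))]
          exact ENNReal.ofReal_le_ofReal (mean_expWeight_le hp0 hz hr _)
      _ = ENNReal.ofReal r * ∫⁻ ω, ENNReal.ofReal (expWeight z (S.length n ω)) ∂μ :=
          lintegral_const_mul' _ _ ENNReal.ofReal_ne_top
      _ ≤ ENNReal.ofReal r * ENNReal.ofReal (z ^ S.initLength * r ^ n) := by gcongr
      _ = _ := by
          rw [← ENNReal.ofReal_mul hr0]
          congr 1
          ring

/-- The rate r(z) = p z⁻² + (1 - p) z equals 1 at z = 1 and has derivative 1 - 3p < 0 there, so a z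
slightly above 1 works. -/
lemma exists_expWeight_rate {p : ℝ} (h1 : 1 / 3 < p) (h2 : p < 1 / 2) :
    ∃ z r : ℝ, 1 ≤ z ∧ 0 < r ∧ r < 1 ∧ r * z ^ 2 = p + (1 - p) * z ^ 3 := by
  have hq : 0 < 1 - p := by linarith
  have hz : 0 < 1 + (3 * p - 1) / 2 := by linarith
  refine ⟨1 + (3 * p - 1) / 2, (p + (1 - p) * (1 + (3 * p - 1) / 2) ^ 3) /
    (1 + (3 * p - 1) / 2) ^ 2, by linarith, by positivity, ?_,
    div_mul_cancel₀ _ (by positivity)⟩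
  rw [div_lt_one (by positivity)]
  obtain ⟨d, hd⟩ : ∃ d, d = (3 * p - 1) / 2 := ⟨_, rfl⟩
  obtain rfl : p = (2 * d + 1) / 3 := by linarith
  rw [← hd]
  have hd0 : 0 < d := by linarith
  have hd1 : d < 1 / 4 := by linarith
  nlinarith [mul_pos hd0 hd0, mul_pos hd0 (sub_pos.2 hd1)]

/-- Equality holds for θ = log₂ (1 / (1 - p)), which is below 1 because p < 1/2. At p = 0 it
degenerates to θ = 0, hence the separate choice 1/2. -/
lemma exists_rpow_exponent {p : ℝ} (h0 : 0 ≤ p) (h2 : p < 1 / 2) :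
    ∃ θ : ℝ, 0 < θ ∧ θ < 1 ∧ 1 ≤ (1 - p) * 2 ^ θ := by
  have hq : 0 < 1 - p := by linarith
  rcases h0.eq_or_lt with rfl | h0
  · refine ⟨1 / 2, by norm_num, by norm_num, ?_⟩
    simpa using Real.one_le_rpow one_le_two (by norm_num : (0 : ℝ) ≤ 2⁻¹)
  have hl2 : 0 < Real.log 2 := Real.log_pos one_lt_two
  refine ⟨Real.logb 2 (1 - p)⁻¹, Real.logb_pos one_lt_two ((one_lt_inv₀ hq).2 (by linarith)), ?_, ?_⟩
  · rw [Real.logb_lt_iff_lt_rpow one_lt_two (inv_pos.2 hq), Real.rpow_one, inv_lt_comm₀ hq two_pos]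
    linarith
  · rw [Real.rpow_logb two_pos (by norm_num) (inv_pos.2 hq), mul_inv_cancel₀ hq.ne']

/-- With a negative expected gain and a duration with exponential tails, the largest bet has
infinite expectation. -/
lemma lintegral_maxBet_eq_top [IsProbabilityMeasure μ] (S : ListSystem μ p)
    (h1 : 1 / 3 < p) (h2 : p < 1 / 2) : ∫⁻ ω, S.maxBet ω ∂μ = ∞ := by
  by_contra hfin
  have hp0 : 0 ≤ p := by linarith
  have hp1 : p ≤ 1 := by linarith
  have hT0 := S.initTarget_pos
  obtain ⟨z, r, hz, hr0, hr1, hr⟩ := exists_expWeight_rate h1 h2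
  obtain ⟨θ, hθ0, hθ1, hθ⟩ := exists_rpow_exponent hp0 h2
  have hz0 : 0 < z := by linarith
  obtain ⟨M, hM⟩ : ∃ M, M = (∫⁻ ω, S.maxBet ω ∂μ).toReal := ⟨_, rfl⟩
  have hM0 : 0 ≤ M := hM ▸ ENNReal.toReal_nonneg
  have hMeq : ∫⁻ ω, S.maxBet ω ∂μ = ENNReal.ofReal M := by rw [hM, ENNReal.ofReal_toReal hfin]
  have hbound (n : ℕ) : S.initTarget ^ θ ≤
      (S.initTarget + n * M) ^ θ * (z ^ S.initLength * r ^ n) ^ (1 - θ) := by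
    have hT := (S.measurable_target n).mono (S.history.le n) le_rfl
    have hl := (S.measurable_length n).mono (S.history.le n) le_rfl
    have hφ : Measurable fun ω => ENNReal.ofReal (expWeight z (S.length n ω)) :=
      (measurable_from_nat (f := fun k => ENNReal.ofReal (expWeight z k))).comp hl
    rw [← ENNReal.ofReal_le_ofReal_iff (by positivity)]
    calc ENNReal.ofReal (S.initTarget ^ θ)
        ≤ ∫⁻ ω, ENNReal.ofReal (S.target n ω ^ θ) ∂μ :=
          S.rpow_initTarget_le_lintegral hp0 hp1 hθ0 hθ1.le hθ n
      _ ≤ ∫⁻ ω, ENNReal.ofReal (S.target n ω) ^ θ *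
            ENNReal.ofReal (expWeight z (S.length n ω)) ^ (1 - θ) ∂μ := by
          refine lintegral_mono fun ω => ?_
          rw [ENNReal.ofReal_rpow_of_nonneg (S.target_nonneg n ω) hθ0.le]
          -- The weight is at least 1 wherever the target can be nonzero.
          by_cases h : S.length n ω = 0
          · simp [S.target_eq_zero h, Real.zero_rpow hθ0.ne']
          · refine le_mul_of_one_le_right' (ENNReal.one_le_rpow ?_ (sub_pos.2 hθ1))
            exact ENNReal.one_le_ofReal.2 (one_le_expWeight hz h)
      _ ≤ (∫⁻ ω, ENNReal.ofReal (S.target n ω) ∂μ) ^ θ *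
            (∫⁻ ω, ENNReal.ofReal (expWeight z (S.length n ω)) ∂μ) ^ (1 - θ) :=
          ENNReal.lintegral_mul_norm_pow_le hT.ennreal_ofReal.aemeasurable hφ.aemeasurable
            hθ0.le (sub_pos.2 hθ1).le (by ring)
      _ ≤ ENNReal.ofReal (S.initTarget + n * M) ^ θ *
            ENNReal.ofReal (z ^ S.initLength * r ^ n) ^ (1 - θ) := by
          gcongr
          · calc _ ≤ ∫⁻ ω, (ENNReal.ofReal S.initTarget + n * S.maxBet ω) ∂μ :=
                  lintegral_mono (S.ofReal_target_le n)
              _ = ENNReal.ofReal S.initTarget + n * ENNReal.ofReal M := by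
                  rw [lintegral_add_left measurable_const,
                    lintegral_const_mul' _ _ (ENNReal.natCast_ne_top n), hMeq]
                  simp
              _ = _ := by
                  rw [ENNReal.ofReal_add hT0.le (by positivity),
                    ENNReal.ofReal_mul (by positivity), ENNReal.ofReal_natCast]
          · exact S.lintegral_expWeight_le hp0 hp1 hz0 hr0.le hr n
      _ = _ := by
          rw [ENNReal.ofReal_rpow_of_nonneg (by positivity) hθ0.le,
            ENNReal.ofReal_rpow_of_nonneg (by positivity) (by linarith),
            ← ENNReal.ofReal_mul (by positivity)]
  obtain ⟨s, hs⟩ : ∃ s, s = r ^ (1 - θ) := ⟨_, rfl⟩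
  have hs0 : 0 ≤ s := hs ▸ by positivity
  have hs1 : s < 1 := hs ▸ Real.rpow_lt_one hr0.le hr1 (sub_pos.2 hθ1)
  obtain ⟨C, hC⟩ : ∃ C, C = (z ^ S.initLength) ^ (1 - θ) := ⟨_, rfl⟩
  -- Using x^θ ≤ 1 + x, the bound becomes linear in n times s^n, which tends to 0.
  have hle (n : ℕ) : S.initTarget ^ θ ≤
      C * (1 + S.initTarget) * s ^ n + C * M * (n * s ^ n) := by
    have hx : 0 ≤ S.initTarget + n * M := by positivity
    have h3 : (S.initTarget + n * M) ^ θ ≤ 1 + (S.initTarget + n * M) :=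
      calc (S.initTarget + n * M) ^ θ ≤ (1 + (S.initTarget + n * M)) ^ θ :=
            Real.rpow_le_rpow hx (by linarith) hθ0.le
        _ ≤ (1 + (S.initTarget + n * M)) ^ (1 : ℝ) :=
            Real.rpow_le_rpow_of_exponent_le (by linarith) hθ1.le
        _ = _ := Real.rpow_one _
    have h4 : (z ^ S.initLength * r ^ n) ^ (1 - θ) = C * s ^ n := by
      rw [Real.mul_rpow (by positivity) (by positivity), hC, hs, ← Real.rpow_natCast_mul hr0.le,
        ← Real.rpow_mul_natCast hr0.le, mul_comm (n : ℝ)]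
    have hC0 : 0 ≤ C := hC ▸ by positivity
    calc _ ≤ _ := hbound n
      _ ≤ (1 + (S.initTarget + n * M)) * (C * s ^ n) := by rw [h4]; gcongr
      _ = _ := by ring
  have hlim := ((tendsto_pow_atTop_nhds_zero_of_lt_one hs0 hs1).const_mul
    (C * (1 + S.initTarget))).add ((tendsto_self_mul_const_pow_of_lt_one hs0 hs1).const_mul (C * M))
  have := ge_of_tendsto' hlim hle
  have hpos := Real.rpow_pos_of_pos hT0 θ
  simp only [mul_zero, add_zero] at this
  linarith

/-! ### The case p ≤ 1/3: the length as a submartingale -/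

/-- The drift is (1 - p) - 2p = 1 - 3p ≥ 0 for k ≥ 2; truncation at k = 1 only raises it. -/
lemma le_mean_length {p : ℝ} (hp0 : 0 ≤ p) (hp : p ≤ 1 / 3) (k : ℕ) :
    (k : ℝ≥0∞) ≤ ENNReal.ofReal p * ((k - 2 : ℕ) : ℝ≥0∞) +
      ENNReal.ofReal (1 - p) * (lengthLose k : ℝ≥0∞) := by
  have hq : 0 ≤ 1 - p := by linarith
  simp only [← ENNReal.ofReal_natCast]
  rw [← ENNReal.ofReal_mul hp0, ← ENNReal.ofReal_mul hq,
    ← ENNReal.ofReal_add (by positivity) (by positivity)]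
  refine ENNReal.ofReal_le_ofReal ?_
  match k with
  | 0 => simp [lengthLose]
  | 1 =>
    norm_num [lengthLose]
    linarith
  | j + 2 =>
    simp only [lengthLose, Nat.add_sub_cancel, Nat.add_eq_zero_iff, OfNat.ofNat_ne_zero, and_false,
      if_false]
    push_cast
    nlinarith

/-- In the regime `p ≤ 1 / 3` the length is a submartingale. -/
lemma setLIntegral_length_le_succ [IsProbabilityMeasure μ] (S : ListSystem μ p) (hp0 : 0 ≤ p)
    (hp : p ≤ 1 / 3) (n : ℕ) {s : Set Ω} (hs : MeasurableSet[S.history n] s) :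
    ∫⁻ ω in s, (S.length n ω : ℝ≥0∞) ∂μ ≤ ∫⁻ ω in s, (S.length (n + 1) ω : ℝ≥0∞) ∂μ := by
  have hs' := S.history.le n _ hs
  have hl := S.measurable_length n
  rw [← lintegral_indicator hs', ← lintegral_indicator hs',
    S.lintegral_succ hp0 n
      (f := s.indicator fun ω => (S.length (n + 1) ω : ℝ≥0∞))
      (g := s.indicator fun ω => ((S.length n ω - 2 : ℕ) : ℝ≥0∞))
      (h := s.indicator fun ω => (lengthLose (S.length n ω) : ℝ≥0∞))
      (((measurable_from_nat (f := fun k => ((k - 2 : ℕ) : ℝ≥0∞))).comp hl).indicator hs)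
      (((measurable_from_nat (f := fun k => (lengthLose k : ℝ≥0∞))).comp hl).indicator hs)
      (fun ω h => by simp only [Set.indicator, S.length_succ_win h])
      (fun ω h => by simp only [Set.indicator, S.length_succ_lose h])]
  refine lintegral_mono fun ω => ?_
  by_cases h : ω ∈ s
  · simpa only [Set.indicator_of_mem h] using le_mean_length hp0 hp _
  · simp [h]

lemma length_le (S : ListSystem μ p) (n : ℕ) (ω : Ω) : S.length n ω ≤ S.initLength + n := by
  induction n with
  | zero => simp [S.length_zero]
  | succ n ih =>
    by_cases h : ω ∈ S.win (n + 1)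
    · rw [S.length_succ_win h]
      omega
    · rw [S.length_succ_lose h]
      unfold lengthLose
      split_ifs <;> omega

lemma submartingale_length [IsProbabilityMeasure μ] (S : ListSystem μ p) (hp0 : 0 ≤ p)
    (hp : p ≤ 1 / 3) : Submartingale (fun n ω => (S.length n ω : ℝ)) S.history μ := by
  have hm n : Measurable[S.history n] fun ω => (S.length n ω : ℝ) :=
    (measurable_from_nat (f := fun k => (k : ℝ))).comp (S.measurable_length n)
  have hm' n : Measurable fun ω => (S.length n ω : ℝ) := (hm n).mono (S.history.le n) le_rfl
  have hint n : Integrable (fun ω => (S.length n ω : ℝ)) μ := by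
    refine Integrable.of_bound (hm' n).aestronglyMeasurable (S.initLength + n : ℕ)
      (ae_of_all _ fun ω => ?_)
    rw [Real.norm_natCast]
    exact_mod_cast S.length_le n ω
  refine submartingale_of_setIntegral_le_succ (fun n => (hm n).stronglyMeasurable) hint
    fun n s hs => ?_
  rw [← ENNReal.ofReal_le_ofReal_iff (integral_nonneg fun ω => by positivity),
    ofReal_integral_eq_lintegral_ofReal (hint n).integrableOn (ae_of_all _ fun ω => by positivity),
    ofReal_integral_eq_lintegral_ofReal (hint (n + 1)).integrableOn
      (ae_of_all _ fun ω => by positivity)]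
  simpa only [ENNReal.ofReal_natCast] using S.setLIntegral_length_le_succ hp0 hp n hs

lemma initLength_le_lintegral [IsProbabilityMeasure μ] (S : ListSystem μ p) (hp0 : 0 ≤ p)
    (hp : p ≤ 1 / 3) (n : ℕ) :
    (S.initLength : ℝ≥0∞) ≤ ∫⁻ ω, (S.length n ω : ℝ≥0∞) ∂μ := by
  induction n with
  | zero => simp [S.length_zero]
  | succ n ih =>
    refine ih.trans ?_
    simpa using S.setLIntegral_length_le_succ hp0 hp n (s := Set.univ) MeasurableSet.univ

/-- A convergent sequence of lengths ends at `0`, since the length changes at every coup played. -/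
lemma eventually_length_eq_zero (S : ListSystem μ p) {ω : Ω} {c : ℝ}
    (h : Filter.Tendsto (fun n => (S.length n ω : ℝ)) Filter.atTop (nhds c)) :
    ∀ᶠ n in Filter.atTop, S.length n ω = 0 := by
  have hd := ((h.comp (Filter.tendsto_add_atTop_nat 1)).sub h).abs
  rw [sub_self, abs_zero] at hd
  filter_upwards [hd.eventually_lt_const one_pos] with n hn
  simp only [Function.comp_apply] at hn
  by_contra h0
  have heq : S.length (n + 1) ω = S.length n ω := by
    have : |((S.length (n + 1) ω : ℤ) - S.length n ω)| < 1 := by exact_mod_cast hn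
    rw [Int.abs_lt_one_iff] at this
    omega
  by_cases hw : ω ∈ S.win (n + 1)
  · have := S.length_win n ω hw
    omega
  · have := S.length_lose n ω hw h0
    omega

/-- If the length does not drift to `0` and the bets grow linearly with it, then the largest bet has
infinite expectation. -/
lemma lintegral_maxBet_eq_top_of_le_bet [IsProbabilityMeasure μ] (S : ListSystem μ p) (hp0 : 0 ≤ p)
    (hp : p ≤ 1 / 3) {c₁ c₂ : ℝ} (hc₁ : 0 < c₁)
    (hbet : ∀ᵐ ω ∂μ, ∀ n : ℕ, 1 ≤ n → (n : ℕ∞) ≤ S.duration ω →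
      c₁ * (S.length (n - 1) ω : ℝ) + c₂ ≤ S.bet n ω) :
    ∫⁻ ω, S.maxBet ω ∂μ = ∞ := by
  by_contra hfin
  -- Solving the lower bound on the bets for the length gives this majorant, integrable if E B* is
  -- finite.
  let bound : Ω → ℝ≥0∞ := fun ω => ENNReal.ofReal c₁⁻¹ * (S.maxBet ω + ENNReal.ofReal |c₂|)
  have hbound_fin : ∫⁻ ω, bound ω ∂μ ≠ ∞ := by
    rw [lintegral_const_mul' _ _ ENNReal.ofReal_ne_top, lintegral_add_right _ measurable_const]
    refine ENNReal.mul_ne_top ENNReal.ofReal_ne_top (ENNReal.add_ne_top.2 ⟨hfin, ?_⟩)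
    simp
  have hle : ∀ᵐ ω ∂μ, ∀ n, (S.length n ω : ℝ≥0∞) ≤ bound ω := by
    filter_upwards [hbet] with ω hω n
    by_cases h0 : S.length n ω = 0
    · simp [h0]
    have h1 : c₁ * (S.length n ω : ℝ) + c₂ ≤ S.bet (n + 1) ω :=
      hω (n + 1) (by omega) (S.succ_le_duration h0)
    have h2 : (S.length n ω : ℝ) ≤ c₁⁻¹ * (S.bet (n + 1) ω + |c₂|) := by
      rw [le_inv_mul_iff₀ hc₁]
      linarith [neg_abs_le c₂]
    calc (S.length n ω : ℝ≥0∞) = ENNReal.ofReal (S.length n ω) :=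
          (ENNReal.ofReal_natCast _).symm
      _ ≤ ENNReal.ofReal (c₁⁻¹ * (S.bet (n + 1) ω + |c₂|)) := ENNReal.ofReal_le_ofReal h2
      _ = ENNReal.ofReal c₁⁻¹ * (ENNReal.ofReal (S.bet (n + 1) ω) + ENNReal.ofReal |c₂|) := by
          rw [ENNReal.ofReal_mul (by positivity),
            ENNReal.ofReal_add (S.bet_nonneg n ω) (abs_nonneg _)]
      _ ≤ bound ω := by
          dsimp only [bound]
          gcongr
          exact S.ofReal_bet_le_maxBet n ω
  have hconv : ∀ᵐ ω ∂μ, ∃ c,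
      Filter.Tendsto (fun n => (S.length n ω : ℝ)) Filter.atTop (nhds c) := by
    -- The majorant bounds the submartingale in L¹, so Doob's convergence theorem applies.
    refine (S.submartingale_length hp0 hp).exists_ae_tendsto_of_bdd
      (R := (∫⁻ ω, bound ω ∂μ).toNNReal) fun n => ?_
    rw [eLpNorm_one_eq_lintegral_enorm, ENNReal.coe_toNNReal hbound_fin]
    refine lintegral_mono_ae ?_
    filter_upwards [hle] with ω hω
    rw [← ofReal_norm, Real.norm_natCast, ENNReal.ofReal_natCast]
    exact hω n
  have hlim : Filter.Tendsto (fun n => ∫⁻ ω, (S.length n ω : ℝ≥0∞) ∂μ) Filter.atTop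
      (nhds (∫⁻ _, 0 ∂μ)) := by
    refine tendsto_lintegral_of_dominated_convergence bound
      (fun n => (measurable_from_nat (f := fun k => (k : ℝ≥0∞))).comp
        ((S.measurable_length n).mono (S.history.le n) le_rfl))
      (fun n => by filter_upwards [hle] with ω hω using hω n) hbound_fin ?_
    filter_upwards [hconv] with ω ⟨c, hc⟩
    refine tendsto_const_nhds.congr' ?_
    filter_upwards [S.eventually_length_eq_zero hc] with n hn
    simp [hn]
  have h0 := ge_of_tendsto' hlim (S.initLength_le_lintegral hp0 hp)
  have := S.initLength_pos
  simp only [lintegral_zero, nonpos_iff_eq_zero, Nat.cast_eq_zero] at h0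
  omega

end ListSystem

theorem theorem1 {Ω : Type*} [MeasurableSpace Ω] (μ : Measure Ω) [IsProbabilityMeasure μ]
    (p : ℝ) (hp0 : 0 ≤ p) (hp1 : p ≤ 1) (S : ListSystem μ p) :
    (1 / 2 < p → ∫⁻ ω, S.maxBet ω ∂μ < ∞) ∧
    (1 / 3 < p → p < 1 / 2 → ∫⁻ ω, S.maxBet ω ∂μ = ∞) ∧
    (p ≤ 1 / 3 →
      (∃ c₁ c₂ : ℝ, 0 < c₁ ∧
        ∀ᵐ ω ∂μ, ∀ n : ℕ, 1 ≤ n → (n : ℕ∞) ≤ S.duration ω →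
          c₁ * (S.length (n - 1) ω : ℝ) + c₂ ≤ S.bet n ω) →
      ∫⁻ ω, S.maxBet ω ∂μ = ∞) :=
  ⟨S.lintegral_maxBet_lt_top hp1, S.lintegral_maxBet_eq_top,
    fun hp ⟨_, _, hc₁, hbet⟩ => S.lintegral_maxBet_eq_top_of_le_bet hp0 hp hc₁ hbet⟩
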